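/- Conventions. Operations and inequalities between vectors are componentwise, $a\wedge b=\min(a,b)$, and $1+\gamma x$ raised to the power $-1/\gamma$ is read as $e^{-x}$ if $\gamma=0$. Spaces such as $[-\infty,\infty)^d$ carry their Borel $\sigma$-algebra. *Stable tail dependence function.* A multivariate generalized extreme-value distribution on $\mathbb R^d$ is a max-stable distribution function $G$ (for every integer $n\ge 1$ there are $a_n\in(0,\infty)^d$ and $b_n\in\mathbb R^d$ with $G(a_nx+b_n)^n=G(x)$ for all $x\in\mathbb R^d$) with generalized extreme-value margins $$G_j(x_j)=\exp\bigl[-\{1+\gamma_j(x_j-\mu_j)/\alpha_j\}^{-1/\gamma_j}\bigr]\quad\text{if } \alpha_j+\gamma_j(x_j-\mu_j)>0,$$ where $\mu_j,\gamma_j\in\mathbb R$ and $\alpha_j>0$. A function $\ell:[0,\infty)^d\to[0,\infty)$ is a *stable tail dependence function* (stdf) if there is such a $G$ with $$G(x)=\exp\bigl[-\ell\{-\log G_1(x_1),\ldots,-\log G_d(x_d)\}\bigr]$$ for all $x\in[-\infty,\infty]^d$ with $G_j(x_j)>0$ for $j=1,\ldots,d$ (with $G_j(+\infty)=1$). *Standardized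 generalized Pareto distribution.* For $\pi\in(0,1]^d$ and a stdf $\ell$ with $\ell(\pi)=1$, $\mathrm{GP}(1,0,\pi,\ell)$ is the probability distribution on $[-\infty,\infty)^d$ with distribution function $$\Pr[Z\le z]=\ell\bigl(\pi e^{-(z\wedge 0)}\bigr)-\ell\bigl(\pi e^{-z}\bigr),\qquad z\in\mathbb R^d.$$ *Spectral random vector.* A random vector $S$ with values in $[-\infty,0]^d$ is a *spectral random vector* if $\Pr[\max(S_1,\ldots,S_d)=0]=1$ and $\Pr[S_j>-\infty]>0$ for all $j=1,\ldots,d$. **Theorem.** Let $\pi\in(0,1]^d$ and let $\ell$ be a stdf with $\ell(\pi)=1$. Then the distribution $\mathrm{GP}(1,0,\pi,\ell)$ exists and is unique, and there is a spectral random vector $S$, unique in distribution, such that $Z\sim\mathrm{GP}(1,0,\pi,\ell)$ satisfies $$Z\overset{d}{=}S+E=(S_1+E,\ldots,S_d+E),$$ where $E$ is a unit exponential random variable independent of $S$. -/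

import Mathlib

open MeasureTheory ProbabilityTheory

/-- The function `x ↦ - log G(x)` for the univariate generalized extreme-value distribution `G`
with location `μ`, shape `γ` and scale `α`, at points `x` with `α + γ (x - μ) > 0`. -/
noncomputable def gevExponent (μ γ α x : ℝ) : ℝ :=
  if γ = 0 then Real.exp (-((x - μ) / α)) else (1 + γ * (x - μ) / α) ^ (-(1 / γ))

/-- `G` is a max-stable (generalized extreme-value) distribution on `ℝ ^ d`: its margins are
three-parameter generalized extreme-value distributions, and for every `n ≥ 1` the law of the
componentwise maximum of `n` independent copies, suitably normalized by `a > 0` and `b`,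
is again `G`.  Each margin is pinned down by its values on `{x | α j + γ j * (x - μ j) > 0}`,
since it tends to `0` or `1` at a finite end point of that interval. -/
structure IsMultivariateGEV {d : ℕ} (μ γ α : Fin d → ℝ) (G : Measure (Fin d → ℝ)) : Prop where
  isProbabilityMeasure : IsProbabilityMeasure G
  scale_pos : ∀ j, 0 < α j
  margin : ∀ (j : Fin d) (x : ℝ), 0 < α j + γ j * (x - μ j) →
    G.real {ω | ω j ≤ x} = Real.exp (-gevExponent (μ j) (γ j) (α j) x)
  maxStable : ∀ n : ℕ, 1 ≤ n → ∃ a b : Fin d → ℝ, (∀ j, 0 < a j) ∧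
    ∀ x : Fin d → ℝ, G.real {ω | ∀ j, ω j ≤ a j * x j + b j} ^ n = G.real {ω | ∀ j, ω j ≤ x j}

/-- `ℓ` is a stable tail dependence function, that is, the dependence structure of some
multivariate generalized extreme-value distribution `G` with margins `G_j`:
`G(x) = exp (-ℓ (-log G_1(x_1), …, -log G_d(x_d)))` whenever all `G_j(x_j) > 0`.
The coordinates `x_j = +∞` (where `G_j(x_j) = 1`) are allowed, so that `(-log G_j(x_j))_j`
runs through all of `[0, ∞) ^ d`.  Only the values of `ℓ` on `[0, ∞) ^ d` matter. -/
def IsStdf {d : ℕ} (ℓ : (Fin d → ℝ) → ℝ) : Prop :=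
  ∃ (μ γ α : Fin d → ℝ) (G : Measure (Fin d → ℝ)), IsMultivariateGEV μ γ α G ∧
    ∀ x : Fin d → EReal, (∀ j, 0 < G.real {ω | (ω j : EReal) ≤ x j}) →
      G.real {ω | ∀ j, (ω j : EReal) ≤ x j} =
        Real.exp (-ℓ (fun j => -Real.log (G.real {ω | (ω j : EReal) ≤ x j})))

/-- `H` is the standardized multivariate generalized Pareto distribution `GP(1, 0, π, ℓ)`: the law
on `[-∞, ∞) ^ d` with distribution function
`H(z) = ℓ (π * exp (-(z ∧ 0))) - ℓ (π * exp (-z))` for `z ∈ ℝ ^ d`. -/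
structure IsStandardGP {d : ℕ} (π : Fin d → ℝ) (ℓ : (Fin d → ℝ) → ℝ)
    (H : Measure (Fin d → EReal)) : Prop where
  isProbabilityMeasure : IsProbabilityMeasure H
  lt_top : ∀ᵐ z ∂H, ∀ j, z j < ⊤
  cdf : ∀ z : Fin d → ℝ, H.real {w | ∀ j, w j ≤ (z j : EReal)} =
    ℓ (fun j => π j * Real.exp (-min (z j) 0)) - ℓ (fun j => π j * Real.exp (-z j))

/-- `ν` is the law of a spectral random vector `S` with values in `[-∞, 0] ^ d`:
`max (S_1, …, S_d) = 0` almost surely and `P (S_j > -∞) > 0` for all `j`. -/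
structure IsSpectralLaw {d : ℕ} (ν : Measure (Fin d → EReal)) : Prop where
  isProbabilityMeasure : IsProbabilityMeasure ν
  nonpos : ∀ᵐ s ∂ν, ∀ j, s j ≤ 0
  max_eq_zero : ν {s | (⨆ j, s j) = 0} = 1
  finite_pos : ∀ j, 0 < ν {s | ⊥ < s j}

/-- The law of `S + E = (S_1 + E, …, S_d + E)`, where `S` has law `ν` and `E` is a unit exponential
random variable independent of `S`. -/
noncomputable def addExpLaw {d : ℕ} (ν : Measure (Fin d → EReal)) : Measure (Fin d → EReal) :=
  (ν.prod (expMeasure 1)).map (fun p j => p.1 j + (p.2 : EReal))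

open Filter Set Topology

/-! ### Subtracting a real number from an extended real. -/

namespace EReal

/-! Write `L z = ℓ (π e⁻ᶻ)`, so that the required distribution function is `L (z ∧ 0) - L z`.
Max-stability gives `L (z + t) = e⁻ᵗ L z` (`translate_eq_exp_mul`), and `exp (-L)` is the
distribution function of some vector `W` (`IsStdf.exists_law`).

Existence: condition `W - log n` on `max W > log n` and take a limit point of these laws on the
compact space `[-∞, ∞]^d` (`exists_probabilityMeasure_cdf`). Uniqueness: real boxes determine a law
without mass at `+∞` (`ext_of_forall_real_box`).

Decomposition: homogeneity of `L` yields `Pr[max Z > t, Z - t ∈ B] = e⁻ᵗ Pr[Z ∈ B]` for `t ≥ 0`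
(`isThresholdStable_of_cdf`). For translation-invariant events this says that `Z - max Z` is
independent of `max Z` and that `max Z` is unit exponential (`IsThresholdStable.map_prodMk`), so `S
= Z - max Z` and `E = max Z`. Conversely, `max S = 0` lets `S` be recovered from `S + E` as its
spectral part, which makes the law of `S` unique. -/

theorem sub_coe_le_iff {a b : EReal} {t : ℝ} : a - t ≤ b ↔ a ≤ b + t :=
  EReal.sub_le_iff_le_add (Or.inl (EReal.coe_ne_bot t)) (Or.inl (EReal.coe_ne_top t))

theorem measurable_sub_prod_coe : Measurable fun p : EReal × ℝ => p.1 - (p.2 : EReal) := by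
  have : (fun p : EReal × ℝ => p.1 - (p.2 : EReal)) = fun p => p.1 + ((-p.2 : ℝ) : EReal) := by
    ext p; rw [EReal.coe_neg, sub_eq_add_neg]
  rw [this]
  fun_prop

end EReal

/-! ### Boxes as determining classes. -/

section Boxes

variable {d : ℕ}

theorem measurableSet_box (x : Fin d → EReal) : MeasurableSet {w : Fin d → EReal | ∀ j, w j ≤ x j} := by
  have : {w : Fin d → EReal | ∀ j, w j ≤ x j} = Iic x := rfl
  rw [this]; exact measurableSet_Iic

theorem isClosed_box (x : Fin d → EReal) : IsClosed {w : Fin d → EReal | ∀ j, w j ≤ x j} := by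
  have : {w : Fin d → EReal | ∀ j, w j ≤ x j} = Iic x := rfl
  rw [this]; exact isClosed_Iic

/-- A finite measure on `[-∞, ∞] ^ d` is determined by its values on all boxes `[-∞, x]`. -/
theorem ext_of_forall_box {H H' : Measure (Fin d → EReal)} [IsFiniteMeasure H]
    (h : ∀ x : Fin d → EReal, H {w | ∀ j, w j ≤ x j} = H' {w | ∀ j, w j ≤ x j}) : H = H' := by
  have hgen : ∀ _ : Fin d, MeasurableSpace.generateFrom (range (Iic : EReal → Set EReal)) =
      (inferInstance : MeasurableSpace EReal) := fun _ =>
    (borel_eq_generateFrom_Iic EReal).symm.trans BorelSpace.measurable_eq.symm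
  have hspan : ∀ _ : Fin d, IsCountablySpanning (range (Iic : EReal → Set EReal)) := fun _ =>
    ⟨fun _ => Iic ⊤, fun _ => mem_range_self _, by simp [iUnion_const]⟩
  refine ext_of_generate_finite _ (generateFrom_eq_pi hgen hspan).symm
    (IsPiSystem.pi fun _ => isPiSystem_Iic) ?_ ?_
  · rintro _ ⟨s, hs, rfl⟩
    choose x hx using fun j => hs j (mem_univ j)
    have : univ.pi s = {w : Fin d → EReal | ∀ j, w j ≤ x j} := by
      ext w; simp [← hx]
    rw [this, h]
  · simpa using h fun _ => ⊤

/-- A finite measure on `[-∞, ∞) ^ d` is determined by its values on the boxes `[-∞, z]` with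
`z` real. -/
theorem ext_of_forall_real_box {H H' : Measure (Fin d → EReal)} [IsFiniteMeasure H]
    [IsFiniteMeasure H'] (hH : ∀ᵐ w ∂H, ∀ j, w j < ⊤) (hH' : ∀ᵐ w ∂H', ∀ j, w j < ⊤)
    (h : ∀ z : Fin d → ℝ, H {w | ∀ j, w j ≤ (z j : EReal)} = H' {w | ∀ j, w j ≤ (z j : EReal)}) :
    H = H' := by
  -- Truncation from above at `n`: the truncated boxes exhaust the full box almost surely, because
  -- no mass sits at `+∞`.
  have upper : ∀ (K : Measure (Fin d → EReal)), (∀ᵐ w ∂K, ∀ j, w j < ⊤) → ∀ x : Fin d → EReal,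
      Tendsto (fun n : ℕ => K {w | ∀ j, w j ≤ min (x j) (n : ℝ)}) atTop
        (𝓝 (K {w | ∀ j, w j ≤ x j})) := by
    intro K hK x
    have hm : Monotone fun n : ℕ => {w : Fin d → EReal | ∀ j, w j ≤ min (x j) (n : ℝ)} := by
      intro m n hmn w hw j
      refine (hw j).trans (min_le_min_left _ ?_)
      exact_mod_cast hmn
    have ht := tendsto_measure_iUnion_atTop (μ := K) hm
    rw [measure_congr (t := {w | ∀ j, w j ≤ x j})] at ht
    · exact ht
    filter_upwards [hK] with w hw
    apply propext
    change w ∈ ⋃ n : ℕ, {w : Fin d → EReal | ∀ j, w j ≤ min (x j) (n : ℝ)} ↔ ∀ j, w j ≤ x j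
    simp only [mem_iUnion, mem_ofPred_eq, le_min_iff, forall_and, exists_and_left, and_iff_left_iff_imp]
    intro _
    have : ∀ j, ∃ n : ℕ, w j ≤ (n : ℝ) := fun j => by
      obtain ⟨n, hn⟩ := exists_nat_ge (w j).toReal
      exact ⟨n, (EReal.le_coe_toReal (hw j).ne).trans (by exact_mod_cast hn)⟩
    choose n hn using this
    refine ⟨Finset.univ.sup n, fun j => (hn j).trans ?_⟩
    exact_mod_cast Finset.le_sup (Finset.mem_univ j)
  -- Truncation from below at `-n`: the boxes decrease exactly to the full box, so mass at `-∞` does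
  -- no harm.
  have lower : ∀ (K : Measure (Fin d → EReal)) [IsFiniteMeasure K], ∀ x : Fin d → EReal,
      Tendsto (fun n : ℕ => K {w | ∀ j, w j ≤ max (x j) ((-n : ℝ) : ℝ)}) atTop
        (𝓝 (K {w | ∀ j, w j ≤ x j})) := by
    intro K _ x
    have hm : Antitone fun n : ℕ =>
        {w : Fin d → EReal | ∀ j, w j ≤ max (x j) ((-n : ℝ) : ℝ)} := by
      intro m n hmn w hw j
      refine (hw j).trans (max_le_max_left _ ?_)
      exact_mod_cast neg_le_neg (Nat.cast_le.2 hmn)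
    have ht := tendsto_measure_iInter_atTop (μ := K)
      (fun n : ℕ => (measurableSet_box fun j => max (x j) ((-n : ℝ) : ℝ)).nullMeasurableSet) hm
      ⟨0, measure_ne_top _ _⟩
    convert! ht using 3
    ext w
    simp only [mem_iInter, mem_ofPred_eq]
    refine ⟨fun hw n j => (hw j).trans (le_max_left _ _), fun hw j => ?_⟩
    by_contra! hlt
    have hbot : ∀ n : ℕ, w j ≤ ((-n : ℝ) : ℝ) := fun n =>
      (le_max_iff.1 (hw n j)).resolve_left (not_le.2 hlt)
    obtain ⟨r, hr1, hr2⟩ := EReal.lt_iff_exists_real_btwn.1 hlt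
    obtain ⟨n, hn⟩ := exists_nat_ge (-r)
    have := hr2.trans_le (hbot n)
    have : r < -n := by exact_mod_cast this
    linarith
  have step : ∀ x : Fin d → EReal, (∀ j, x j ≠ ⊥) →
      H {w | ∀ j, w j ≤ x j} = H' {w | ∀ j, w j ≤ x j} := by
    intro x hx
    refine tendsto_nhds_unique (upper H hH x) ((upper H' hH' x).congr fun n => ?_)
    have hc : ∀ j, ((min (x j) ((n : ℝ) : EReal)).toReal : EReal) = min (x j) ((n : ℝ) : EReal) :=
      fun j => EReal.coe_toReal ((min_le_right _ _).trans_lt (EReal.coe_lt_top _)).ne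
        (lt_min (bot_lt_iff_ne_bot.2 (hx j)) (EReal.bot_lt_coe _)).ne'
    simpa only [hc] using (h fun j => (min (x j) ((n : ℝ) : EReal)).toReal).symm
  refine ext_of_forall_box fun x => ?_
  refine tendsto_nhds_unique (lower H x) ((lower H' x).congr fun n => (step _ fun j => ?_).symm)
  exact ((EReal.bot_lt_coe _).trans_le (le_max_right _ _)).ne'

end Boxes

/-! ### Polar decomposition into spectral part and maximum. -/

section Polar

variable {d : ℕ}

/-- The spectral component `z - max z` of a point `z`. -/
noncomputable def spectralPart (z : Fin d → EReal) : Fin d → EReal :=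
  fun j => z j - ((⨆ k, z k).toReal : EReal)

theorem measurable_iSup_coord : Measurable fun z : Fin d → EReal => ⨆ k, z k :=
  Measurable.iSup fun k => measurable_pi_apply k

theorem measurable_spectralPart : Measurable (spectralPart (d := d)) :=
  measurable_pi_lambda _ fun j => EReal.measurable_sub_prod_coe.comp
    ((measurable_pi_apply j).prodMk measurable_iSup_coord.ereal_toReal)

theorem measurable_addCoe :
    Measurable fun p : (Fin d → EReal) × ℝ => fun j => p.1 j + (p.2 : EReal) := by
  fun_prop

theorem iSup_add_coe [Nonempty (Fin d)] (z : Fin d → EReal) (t : ℝ) :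
    ⨆ k, (z k + (t : EReal)) = (⨆ k, z k) + t := by
  apply le_antisymm
  · exact iSup_le fun k => add_le_add_left (le_iSup z k) _
  · obtain ⟨j, hj⟩ := exists_eq_ciSup_of_finite (f := z)
    rw [← hj]
    exact le_iSup (fun k => z k + (t : EReal)) j

/-- The shift cancels against that of the maximum. At maximum `⊤` the default `toReal ⊤ = 0` would
let the shift survive in finite coordinates. -/
theorem spectralPart_add_coe [Nonempty (Fin d)] {z : Fin d → EReal} (htop : ⨆ k, z k ≠ ⊤)
    (hbot : ⨆ k, z k ≠ ⊥) (t : ℝ) :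
    spectralPart (fun j => z j + (t : EReal)) = spectralPart z := by
  ext j
  simp only [spectralPart, iSup_add_coe]
  lift (⨆ k, z k) to ℝ using ⟨htop, hbot⟩ with m
  rw [← EReal.coe_add, EReal.toReal_coe, EReal.toReal_coe]
  induction h : z j with
  | bot => simp
  | top => rw [EReal.top_add_coe, EReal.top_sub_coe, EReal.top_sub_coe]
  | coe x => norm_cast; ring

theorem spectralPart_of_iSup_eq_zero {z : Fin d → EReal} (h : ⨆ k, z k = 0) :
    spectralPart z = z := by
  ext j; simp [spectralPart, h]

theorem IsSpectralLaw.ae_iSup_eq_zero {ν : Measure (Fin d → EReal)} (h : IsSpectralLaw ν) :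
    ∀ᵐ s ∂ν, ⨆ j, s j = 0 := by
  have := h.isProbabilityMeasure
  have hm : MeasurableSet {s : Fin d → EReal | ⨆ j, s j = 0} :=
    measurable_iSup_coord (measurableSet_singleton 0)
  exact (prob_compl_eq_zero_iff hm).2 h.max_eq_zero

/-- A spectral law is the law of the spectral part of `S + E`. -/
theorem IsSpectralLaw.map_spectralPart_addExpLaw [Nonempty (Fin d)]
    {ν : Measure (Fin d → EReal)} (h : IsSpectralLaw ν) :
    (addExpLaw ν).map spectralPart = ν := by
  have := h.isProbabilityMeasure
  have := isProbabilityMeasure_expMeasure one_pos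
  rw [addExpLaw, Measure.map_map measurable_spectralPart measurable_addCoe]
  have hfst : (ν.prod (expMeasure 1)).map Prod.fst = ν := by simp
  have hae : ∀ᵐ p ∂(ν.prod (expMeasure 1)), ⨆ j, p.1 j = 0 :=
    Measure.quasiMeasurePreserving_fst.ae h.ae_iSup_eq_zero
  refine (Measure.map_congr ?_).trans hfst
  filter_upwards [hae] with p hp
  change spectralPart (fun j => p.1 j + (p.2 : EReal)) = p.1
  rw [spectralPart_add_coe (by simp [hp]) (by simp [hp]), spectralPart_of_iSup_eq_zero hp]

/-- A probability measure `H` on `[-∞, ∞) ^ d` concentrated on `{max > 0}` and stable under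
conditioning on `max > t` followed by the translation by `-t`. -/
structure IsThresholdStable (H : Measure (Fin d → EReal)) : Prop where
  isProbabilityMeasure : IsProbabilityMeasure H
  lt_top : ∀ᵐ z ∂H, ∀ j, z j < ⊤
  pos : ∀ᵐ z ∂H, 0 < ⨆ j, z j
  stable : ∀ t : ℝ, 0 ≤ t → ∀ B, MeasurableSet B →
    H ({z | (t : EReal) < ⨆ j, z j} ∩ {z | (fun j => z j - (t : EReal)) ∈ B}) =
      ENNReal.ofReal (Real.exp (-t)) * H B

theorem IsThresholdStable.ae_iSup_lt_top {H : Measure (Fin d → EReal)} (h : IsThresholdStable H) :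
    ∀ᵐ z ∂H, ⨆ j, z j < ⊤ := by
  filter_upwards [h.lt_top] with z hz
  rcases isEmpty_or_nonempty (Fin d) with he | hne
  · simp
  · obtain ⟨j, hj⟩ := exists_eq_ciSup_of_finite (f := z)
    exact hj ▸ hz j

theorem expMeasure_one_Ioi (t : ℝ) :
    expMeasure 1 (Ioi t) = ENNReal.ofReal (Real.exp (-max t 0)) := by
  have := isProbabilityMeasure_expMeasure one_pos
  rw [← compl_Iic, prob_compl_eq_one_sub measurableSet_Iic, ← ofReal_cdf,
    cdf_expMeasure_eq one_pos]
  split_ifs with ht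
  · rw [← ENNReal.ofReal_one, ← ENNReal.ofReal_sub _ (by simpa using ht), max_eq_left ht]
    simp
  · rw [max_eq_right (not_le.1 ht).le]
    simp

theorem IsThresholdStable.nonempty {H : Measure (Fin d → EReal)} (h : IsThresholdStable H) :
    Nonempty (Fin d) := by
  have := h.isProbabilityMeasure
  obtain ⟨z, hz⟩ := h.pos.exists
  by_contra hne
  rw [not_nonempty_iff] at hne
  simp at hz

/-- The spectral part and the maximum are independent, and the maximum is unit exponential. -/
theorem IsThresholdStable.map_prodMk {H : Measure (Fin d → EReal)} (h : IsThresholdStable H) :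
    H.map (fun z => (spectralPart z, (⨆ j, z j).toReal)) =
      (H.map spectralPart).prod (expMeasure 1) := by
  have := h.isProbabilityMeasure
  have := h.nonempty
  have := isProbabilityMeasure_expMeasure one_pos
  have hmax : Measurable fun z : Fin d → EReal => (⨆ j, z j).toReal :=
    measurable_iSup_coord.ereal_toReal
  have : IsProbabilityMeasure (H.map (spectralPart (d := d))) :=
    Measure.isProbabilityMeasure_map measurable_spectralPart.aemeasurable
  have key : ∀ A, MeasurableSet A → ∀ t : ℝ,
      H (spectralPart ⁻¹' A ∩ (fun z => (⨆ j, z j).toReal) ⁻¹' Ioi t) =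
        H (spectralPart ⁻¹' A) * expMeasure 1 (Ioi t) := by
    intro A hA t
    -- Since `max Z > 0` almost surely, a negative level may be replaced by `0`. Stability is then
    -- applied to the event `spectralPart ⁻¹' A`, which translation preserves almost surely.
    rw [expMeasure_one_Ioi, mul_comm, ← h.stable _ (le_max_right t 0) _ (measurable_spectralPart hA)]
    apply measure_congr
    filter_upwards [h.pos, h.ae_iSup_lt_top] with z h0 h1
    apply propext
    change (spectralPart z ∈ A ∧ t < (⨆ j, z j).toReal) ↔
      (((max t 0 : ℝ) : EReal) < ⨆ j, z j ∧ spectralPart (fun j => z j - ((max t 0 : ℝ) : EReal)) ∈ A)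
    have hs := spectralPart_add_coe (z := z) h1.ne (EReal.bot_lt_zero.trans h0).ne' (-max t 0)
    simp only [EReal.coe_neg, ← sub_eq_add_neg] at hs
    rw [hs]
    lift (⨆ k, z k) to ℝ using ⟨h1.ne, (EReal.bot_lt_zero.trans h0).ne'⟩ with m
    have h0' : 0 < m := by exact_mod_cast h0
    rw [EReal.coe_lt_coe_iff, max_lt_iff, EReal.toReal_coe]
    tauto
  refine (Measure.prod_eq_generateFrom MeasurableSpace.generateFrom_measurableSet
    ((borel_eq_generateFrom_Ioi ℝ).symm.trans BorelSpace.measurable_eq.symm)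
    MeasurableSpace.isPiSystem_measurableSet isPiSystem_Ioi
    (Measure.toFiniteSpanningSetsIn _) ⟨fun n => Ioi (-n : ℝ), fun n => mem_range_self _,
      fun n => measure_lt_top _ _, ?_⟩ ?_).symm
  · refine eq_univ_of_forall fun x => mem_iUnion.2 ?_
    obtain ⟨n, hn⟩ := exists_nat_gt (-x)
    exact ⟨n, by simp only [mem_Ioi]; linarith⟩
  · rintro A (hA : MeasurableSet A) _ ⟨t, rfl⟩
    rw [Measure.map_apply (measurable_spectralPart.prodMk hmax) (hA.prod measurableSet_Ioi),
      Measure.map_apply measurable_spectralPart hA, ← key A hA t]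
    rfl

theorem IsThresholdStable.eq_addExpLaw {H : Measure (Fin d → EReal)} (h : IsThresholdStable H) :
    H = addExpLaw (H.map spectralPart) := by
  have hmax : Measurable fun z : Fin d → EReal => (⨆ j, z j).toReal :=
    measurable_iSup_coord.ereal_toReal
  rw [addExpLaw, ← h.map_prodMk,
    Measure.map_map measurable_addCoe (measurable_spectralPart.prodMk hmax)]
  -- This holds everywhere, not just almost everywhere: `toReal` always subtracts and adds back the
  -- same real number.
  have : (fun p : (Fin d → EReal) × ℝ => fun j => p.1 j + (p.2 : EReal)) ∘
      (fun z => (spectralPart z, (⨆ j, z j).toReal)) = id := by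
    ext z j
    simp [spectralPart, EReal.sub_add_cancel]
  rw [this, Measure.map_id]

theorem IsThresholdStable.isSpectralLaw {H : Measure (Fin d → EReal)} (h : IsThresholdStable H)
    (hfin : ∀ j, 0 < H {z | ⊥ < z j}) : IsSpectralLaw (H.map spectralPart) := by
  have := h.isProbabilityMeasure
  have := h.nonempty
  have hP : IsProbabilityMeasure (H.map (spectralPart (d := d))) :=
    Measure.isProbabilityMeasure_map measurable_spectralPart.aemeasurable
  have hm : MeasurableSet {s : Fin d → EReal | ⨆ j, s j = 0} :=
    measurable_iSup_coord (measurableSet_singleton 0)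
  have hsup : ∀ᵐ s ∂(H.map (spectralPart (d := d))), ⨆ j, s j = 0 := by
    rw [ae_map_iff measurable_spectralPart.aemeasurable hm]
    filter_upwards [h.pos, h.ae_iSup_lt_top] with z h0 h1
    have hs := iSup_add_coe z (-(⨆ k, z k).toReal)
    simp only [EReal.coe_neg, ← sub_eq_add_neg] at hs
    change ⨆ j, (z j - ((⨆ k, z k).toReal : EReal)) = 0
    rw [hs, EReal.coe_toReal h1.ne (EReal.bot_lt_zero.trans h0).ne']
    exact EReal.sub_self h1.ne (EReal.bot_lt_zero.trans h0).ne'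
  refine ⟨hP, ?_, (prob_compl_eq_zero_iff hm).1 hsup, fun j => ?_⟩
  · filter_upwards [hsup] with s hs j
    exact hs ▸ le_iSup s j
  · have hmj : MeasurableSet {s : Fin d → EReal | ⊥ < s j} :=
      measurable_pi_apply j measurableSet_Ioi
    rw [Measure.map_apply measurable_spectralPart hmj]
    refine (hfin j).trans_le (measure_mono fun z hz => ?_)
    change ⊥ < z j - ((⨆ k, z k).toReal : EReal)
    rw [bot_lt_iff_ne_bot]
    intro hb
    have hz' : ⊥ < z j := hz
    have := congrArg (· + ((⨆ k, z k).toReal : EReal)) hb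
    simp only [EReal.sub_add_cancel, EReal.bot_add] at this
    exact hz'.ne' this

end Polar

/-! ### Existence and threshold stability from the distribution function. -/

section ParetoCdf

variable {d : ℕ}

theorem compl_box_const (t : EReal) :
    {w : Fin d → EReal | ∀ j, w j ≤ t}ᶜ = {w | t < ⨆ j, w j} := by
  ext w
  simp [lt_iSup_iff]

theorem measurable_sub_const_coe (t : ℝ) :
    Measurable fun (z : Fin d → EReal) j => z j - (t : EReal) := by
  have : (fun (z : Fin d → EReal) j => z j - (t : EReal)) = fun z j => z j + ((-t : ℝ) : EReal) := by
    ext z j; rw [EReal.coe_neg, sub_eq_add_neg]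
  rw [this]
  fun_prop

/-- Both conditioning on exceeding `t` and the explicit distribution function are handled through
this difference of nested boxes. -/
theorem setOf_lt_iSup_inter_preimage_sub (z : Fin d → ℝ) (t : ℝ) :
    {w : Fin d → EReal | (t : EReal) < ⨆ j, w j} ∩
        (fun (w : Fin d → EReal) j => w j - (t : EReal)) ⁻¹' {w | ∀ j, w j ≤ (z j : EReal)} =
      {w : Fin d → EReal | ∀ j, w j ≤ ((z j + t : ℝ) : EReal)} \
        {w : Fin d → EReal | ∀ j, w j ≤ ((min (z j) 0 + t : ℝ) : EReal)} := by
  ext w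
  simp only [mem_inter_iff, mem_preimage, mem_ofPred_eq, Set.mem_sdiff, EReal.sub_coe_le_iff,
    ← EReal.coe_add, ← min_add_add_right, zero_add, EReal.coe_strictMono.monotone.map_min,
    le_min_iff, forall_and, ← not_le, iSup_le_iff]
  tauto

theorem box_min_add_subset (z : Fin d → ℝ) (t : ℝ) :
    {w : Fin d → EReal | ∀ j, w j ≤ ((min (z j) 0 + t : ℝ) : EReal)} ⊆
      {w : Fin d → EReal | ∀ j, w j ≤ ((z j + t : ℝ) : EReal)} := fun _ hw j =>
  (hw j).trans (by exact_mod_cast add_le_add_left (min_le_left _ _) _)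

theorem measure_eq_ofReal_of_cdf {H : Measure (Fin d → EReal)} [IsFiniteMeasure H]
    {L : (Fin d → ℝ) → ℝ}
    (cdf : ∀ z : Fin d → ℝ, H.real {w | ∀ j, w j ≤ (z j : EReal)} =
      L (fun j => min (z j) 0) - L z) (z : Fin d → ℝ) :
    H {w | ∀ j, w j ≤ (z j : EReal)} = ENNReal.ofReal (L (fun j => min (z j) 0) - L z) := by
  rw [← cdf, ofReal_measureReal]

/-- On the nested boxes the terms `L ((z + t) ∧ 0)` cancel because `t ≥ 0`; homogeneity turns what
is left into `e⁻ᵗ (L (z ∧ 0) - L z)`. Positivity of the maximum is the vanishing of the distribution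
function at `0`. -/
theorem isThresholdStable_of_cdf {H : Measure (Fin d → EReal)} [IsProbabilityMeasure H]
    {L : (Fin d → ℝ) → ℝ} (hL : ∀ z t, L (fun j => z j + t) = Real.exp (-t) * L z)
    (lt_top : ∀ᵐ z ∂H, ∀ j, z j < ⊤)
    (cdf : ∀ z : Fin d → ℝ, H.real {w | ∀ j, w j ≤ (z j : EReal)} =
      L (fun j => min (z j) 0) - L z) : IsThresholdStable H := by
  refine ⟨inferInstance, lt_top, ?_, fun t ht B hB => ?_⟩
  · have h0 := measure_eq_ofReal_of_cdf cdf fun _ => 0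
    have hc : {w : Fin d → EReal | ¬ 0 < ⨆ j, w j} = {w | ∀ j, w j ≤ ((0 : ℝ) : EReal)} := by
      ext w; simp
    rw [ae_iff, hc, h0]
    simp
  have hT : MeasurableSet {z : Fin d → EReal | (t : EReal) < ⨆ j, z j} :=
    measurable_iSup_coord measurableSet_Ioi
  have hsub := measurable_sub_const_coe (d := d) t
  have : IsFiniteMeasure (ENNReal.ofReal (Real.exp (-t)) • H) :=
    Measure.smul_finite H ENNReal.ofReal_ne_top
  have heq : (H.restrict {z | (t : EReal) < ⨆ j, z j}).map (fun z j => z j - (t : EReal)) =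
      ENNReal.ofReal (Real.exp (-t)) • H := by
    refine ext_of_forall_real_box ?_ (Measure.ae_smul_measure lt_top _) fun z => ?_
    · have hm : MeasurableSet {w : Fin d → EReal | ∀ j, w j < ⊤} := by
        simp only [ofPred_forall]
        exact MeasurableSet.iInter fun j => measurable_pi_apply j measurableSet_Iio
      rw [ae_map_iff hsub.aemeasurable hm]
      filter_upwards [ae_restrict_of_ae lt_top] with w hw j
      rw [sub_eq_add_neg, ← EReal.coe_neg]
      exact EReal.add_lt_top (hw j).ne (EReal.coe_ne_top _)
    · rw [Measure.map_apply hsub (measurableSet_box _),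
        Measure.restrict_apply (hsub (measurableSet_box _)), Measure.smul_apply, smul_eq_mul,
        measure_eq_ofReal_of_cdf cdf, ← ENNReal.ofReal_mul (Real.exp_pos _).le]
      have hmin : ∀ j, min (min (z j) 0 + t) 0 = min (z j + t) 0 := fun j => by
        rw [← min_add_add_right, zero_add, min_assoc, min_eq_right ht]
      rw [inter_comm, setOf_lt_iSup_inter_preimage_sub, ← ofReal_measureReal,
        measureReal_sdiff (box_min_add_subset z t) (measurableSet_box _),
        cdf fun j => z j + t, cdf fun j => min (z j) 0 + t]
      simp only [hmin, hL]
      congr 1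
      ring
  have := congrArg (fun K : Measure (Fin d → EReal) => K B) heq
  simp only [Measure.map_apply hsub hB, Measure.restrict_apply (hsub hB), Measure.smul_apply,
    smul_eq_mul] at this
  rw [← this, inter_comm]
  rfl

/-- The survival functions `exp (-a x)` linearize at `0`. -/
theorem tendsto_exp_sub_exp_div (a b : ℝ) :
    Tendsto (fun n : ℕ => (Real.exp (-(a / n)) - Real.exp (-(b / n))) / (1 - Real.exp (-(1 / n))))
      atTop (𝓝 (b - a)) := by
  have lin : ∀ c : ℝ, Tendsto (fun n : ℕ => (n : ℝ) * (1 - Real.exp (-(c / n)))) atTop (𝓝 c) := by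
    intro c
    have hd : HasDerivAt (fun x : ℝ => 1 - Real.exp (-(c * x))) c 0 := by
      have := (((hasDerivAt_id (0 : ℝ)).const_mul c).neg.exp).const_sub 1
      simpa using this
    have ht : Tendsto (fun n : ℕ => (n : ℝ)⁻¹) atTop (𝓝[≠] 0) :=
      tendsto_nhdsWithin_iff.2 ⟨tendsto_inv_atTop_nhds_zero_nat,
        (eventually_gt_atTop 0).mono fun n hn => by
          simp only [mem_compl_iff, mem_singleton_iff, inv_eq_zero]; exact_mod_cast hn.ne'⟩
    refine (hd.tendsto_slope.comp ht).congr fun n => ?_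
    simp [slope_def_field, div_eq_mul_inv, mul_comm]
  have h := ((lin b).sub (lin a)).div (lin 1) one_ne_zero
  rw [div_one] at h
  refine h.congr' ((eventually_gt_atTop 0).mono fun n hn => ?_)
  have hn' : (n : ℝ) ≠ 0 := by exact_mod_cast hn.ne'
  rw [Pi.div_apply, ← mul_sub, mul_div_mul_left _ _ hn']
  congr 1
  ring

/-- If `Q` has distribution function `exp (-L)`, some probability measure on `[-∞, ∞] ^ d` has
distribution function `L (z ∧ 0) - L z`: it is a limit of the laws of `W - log n` given
`W ≰ log n`, where `W` has law `Q`. -/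
theorem exists_probabilityMeasure_cdf {L : (Fin d → ℝ) → ℝ} (hanti : Antitone L)
    (hL : ∀ z t, L (fun j => z j + t) = Real.exp (-t) * L z) (hL0 : L 0 = 1)
    (Q : Measure (Fin d → EReal)) [IsProbabilityMeasure Q]
    (hQ : ∀ z : Fin d → ℝ, Q.real {w | ∀ j, w j ≤ (z j : EReal)} = Real.exp (-L z)) :
    ∃ H : Measure (Fin d → EReal), IsProbabilityMeasure H ∧
      ∀ z : Fin d → ℝ, H.real {w | ∀ j, w j ≤ (z j : EReal)} = L (fun j => min (z j) 0) - L z := by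
  have hLc : ∀ t : ℝ, L (fun _ => t) = Real.exp (-t) := fun t => by
    have := hL 0 t
    simpa [hL0] using this
  let A : ℕ → Set (Fin d → EReal) := fun n => {w | (Real.log n : EReal) < ⨆ j, w j}
  have hA : ∀ n, MeasurableSet (A n) := fun n => measurable_iSup_coord measurableSet_Ioi
  have hAreal : ∀ n : ℕ, 0 < n → Q.real (A n) = 1 - Real.exp (-(1 / n)) := fun n hn => by
    change Q.real {w | (Real.log n : EReal) < ⨆ j, w j} = _
    rw [← compl_box_const, probReal_compl_eq_one_sub (measurableSet_box _), hQ fun _ => Real.log n, hLc,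
      Real.exp_neg (Real.log n), Real.exp_log (by exact_mod_cast hn), one_div]
  have hApos : ∀ n : ℕ, 0 < n → 0 < Q.real (A n) := fun n hn => by
    rw [hAreal n hn, sub_pos, Real.exp_lt_one_iff]
    simpa using hn
  have hsub := measurable_sub_const_coe (d := d)
  let K : ℕ → Measure (Fin d → EReal) := fun n =>
    (Q[|A n]).map fun w j => w j - (Real.log n : EReal)
  have hKprob : ∀ n, 0 < n → IsProbabilityMeasure (K n) := fun n hn => by
    have : IsProbabilityMeasure (Q[|A n]) :=
      cond_isProbabilityMeasure fun h0 => (hApos n hn).ne' (by simp [Measure.real, h0])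
    exact Measure.isProbabilityMeasure_map (hsub _).aemeasurable
  have hK : ∀ n : ℕ, 0 < n → ∀ z : Fin d → ℝ, (K n).real {w | ∀ j, w j ≤ (z j : EReal)} =
      (Real.exp (-(L z / n)) - Real.exp (-(L (fun j => min (z j) 0) / n))) /
        (1 - Real.exp (-(1 / n))) := by
    intro n hn z
    have hn' : (0 : ℝ) < n := by exact_mod_cast hn
    have hbox : ∀ z : Fin d → ℝ, Q.real {w | ∀ j, w j ≤ ((z j + Real.log n : ℝ) : EReal)} =
        Real.exp (-(L z / n)) := fun z => by
      rw [hQ fun j => z j + Real.log n, hL, Real.exp_neg (Real.log n),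
        Real.exp_log hn', inv_mul_eq_div]
    rw [map_measureReal_apply (hsub _) (measurableSet_box _), Measure.real, cond_apply (hA n),
      ENNReal.toReal_mul, ENNReal.toReal_inv, ← Measure.real, ← Measure.real,
      setOf_lt_iSup_inter_preimage_sub,
      measureReal_sdiff (box_min_add_subset z _) (measurableSet_box _), hbox, hbox fun j => min (z j) 0, hAreal n hn,
      inv_mul_eq_div]
  let P : ℕ → ProbabilityMeasure (Fin d → EReal) := fun n => ⟨K (n + 1), hKprob _ n.succ_pos⟩
  -- A limit along a free ultrafilter replaces the choice of a convergent subsequence.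
  obtain ⟨H, -, hH⟩ := isCompact_univ.ultrafilter_le_nhds
    ((hyperfilter ℕ).map P) (by simp)
  have hlim : Tendsto P (hyperfilter ℕ : Filter ℕ) (𝓝 H) := hH
  have hbox : ∀ z : Fin d → ℝ, Tendsto
      (fun n => ((P n : ProbabilityMeasure _) : Measure (Fin d → EReal))
        {w | ∀ j, w j ≤ (z j : EReal)}) (hyperfilter ℕ : Filter ℕ)
      (𝓝 (ENNReal.ofReal (L (fun j => min (z j) 0) - L z))) := by
    intro z
    have ht := ((tendsto_exp_sub_exp_div (L z) (L fun j => min (z j) 0)).comp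
      (tendsto_add_atTop_nat 1)).mono_left (Nat.hyperfilter_le_atTop)
    refine (ENNReal.tendsto_ofReal ht).congr fun n => ?_
    rw [Function.comp_apply, ← hK _ n.succ_pos z]
    have := hKprob (n + 1) n.succ_pos
    exact ofReal_measureReal
  have hupper : ∀ z : Fin d → ℝ, ENNReal.ofReal (L (fun j => min (z j) 0) - L z) ≤
      (H : Measure (Fin d → EReal)) {w | ∀ j, w j ≤ (z j : EReal)} := fun z => by
    rw [← (hbox z).limsup_eq]
    exact ProbabilityMeasure.limsup_measure_closed_le_of_tendsto hlim (isClosed_box _)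
  -- Boxes are not known to be continuity sets of `H`. The box is enlarged to an open one by `ε`,
  -- and homogeneity makes the cost a factor `e^(-ε)`, which disappears as `ε ↓ 0`.
  have hlower : ∀ (z : Fin d → ℝ) (ε : ℝ), 0 < ε →
      (H : Measure (Fin d → EReal)) {w | ∀ j, w j ≤ (z j : EReal)} ≤
        ENNReal.ofReal (L (fun j => min (z j) 0) - Real.exp (-ε) * L z) := by
    intro z ε hε
    have hopen : IsOpen {w : Fin d → EReal | ∀ j, w j < ((z j + ε : ℝ) : EReal)} := by
      simp only [ofPred_forall]
      exact isOpen_iInter_of_finite fun j => isOpen_lt (continuous_apply j) continuous_const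
    calc (H : Measure (Fin d → EReal)) {w | ∀ j, w j ≤ (z j : EReal)}
        ≤ (H : Measure (Fin d → EReal)) {w | ∀ j, w j < ((z j + ε : ℝ) : EReal)} :=
          measure_mono fun w hw j => (hw j).trans_lt (by exact_mod_cast lt_add_of_pos_right _ hε)
      _ ≤ liminf (fun n => ((P n : ProbabilityMeasure _) : Measure (Fin d → EReal))
            {w | ∀ j, w j < ((z j + ε : ℝ) : EReal)}) (hyperfilter ℕ : Filter ℕ) :=
          ProbabilityMeasure.le_liminf_measure_open_of_tendsto hlim hopen
      _ ≤ liminf (fun n => ((P n : ProbabilityMeasure _) : Measure (Fin d → EReal))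
            {w | ∀ j, w j ≤ ((z j + ε : ℝ) : EReal)}) (hyperfilter ℕ : Filter ℕ) :=
          liminf_le_liminf (Eventually.of_forall fun n => measure_mono fun w hw j => (hw j).le)
      _ = ENNReal.ofReal (L (fun j => min (z j + ε) 0) - L fun j => z j + ε) :=
          (hbox fun j => z j + ε).liminf_eq
      _ ≤ ENNReal.ofReal (L (fun j => min (z j) 0) - Real.exp (-ε) * L z) := by
          rw [hL]
          refine ENNReal.ofReal_le_ofReal (sub_le_sub_right (hanti fun j => ?_) _)
          exact min_le_min_right _ (by linarith)
  refine ⟨H, inferInstance, fun z => ?_⟩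
  have hnn : 0 ≤ L (fun j => min (z j) 0) - L z :=
    sub_nonneg.2 (hanti fun j => min_le_left _ _)
  rw [← ENNReal.toReal_ofReal hnn]
  refine congrArg ENNReal.toReal (le_antisymm ?_ (hupper z))
  have ht : Tendsto (fun ε : ℝ => ENNReal.ofReal (L (fun j => min (z j) 0) - Real.exp (-ε) * L z))
      (𝓝[>] 0) (𝓝 (ENNReal.ofReal (L (fun j => min (z j) 0) - L z))) := by
    have hc : Continuous fun ε : ℝ => L (fun j => min (z j) 0) - Real.exp (-ε) * L z := by fun_prop
    have := (ENNReal.tendsto_ofReal (hc.tendsto 0)).mono_left (nhdsWithin_le_nhds (s := Ioi 0))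
    simpa using this
  exact ge_of_tendsto ht (eventually_nhdsWithin_of_forall fun ε hε => hlower z ε hε)

/-- A distribution function of generalized Pareto form leaves no mass at `+∞`. -/
theorem ae_lt_top_of_cdf {H : Measure (Fin d → EReal)} [IsProbabilityMeasure H]
    {L : (Fin d → ℝ) → ℝ} (hL : ∀ z t, L (fun j => z j + t) = Real.exp (-t) * L z) (hL0 : L 0 = 1)
    (cdf : ∀ z : Fin d → ℝ, H.real {w | ∀ j, w j ≤ (z j : EReal)} =
      L (fun j => min (z j) 0) - L z) : ∀ᵐ z ∂H, ∀ j, z j < ⊤ := by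
  have hLc : ∀ t : ℝ, L (fun _ => t) = Real.exp (-t) := fun t => by
    have := hL 0 t
    simpa [hL0] using this
  have hle : ∀ n : ℕ, H {w : Fin d → EReal | ¬ ∀ j, w j < ⊤} ≤ ENNReal.ofReal (Real.exp (-n)) := by
    intro n
    have h1 : H {w : Fin d → EReal | ∀ j, w j ≤ ((n : ℝ) : EReal)}ᶜ =
        ENNReal.ofReal (Real.exp (-n)) := by
      rw [← ofReal_measureReal, probReal_compl_eq_one_sub (measurableSet_box _), cdf fun _ => n]
      simp [hLc]
    rw [← h1]
    exact measure_mono fun w hw hw' => hw fun j => (hw' j).trans_lt (EReal.coe_lt_top _)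
  rw [ae_iff]
  refine le_antisymm (ge_of_tendsto' (x := atTop) ?_ hle) zero_le
  have := ENNReal.tendsto_ofReal (Real.tendsto_exp_neg_atTop_nhds_zero.comp
    (tendsto_natCast_atTop_atTop (R := ℝ)))
  simpa using this

end ParetoCdf

/-! ### Quantiles of the extreme-value margins. -/

section Quantile

/-- The value at which the generalized extreme-value distribution function equals
`exp (-exp (-z))`. -/
noncomputable def gevQuantile (μ γ α z : ℝ) : ℝ :=
  if γ = 0 then μ + α * z else μ + α * ((Real.exp (γ * z) - 1) / γ)

theorem continuous_gevQuantile (μ γ α : ℝ) : Continuous (gevQuantile μ γ α) := by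
  unfold gevQuantile
  split_ifs <;> fun_prop

theorem monotone_gevQuantile (μ γ : ℝ) {α : ℝ} (hα : 0 < α) : Monotone (gevQuantile μ γ α) := by
  intro x y hxy
  unfold gevQuantile
  split_ifs with hγ
  · gcongr
  · refine (add_le_add_iff_left _).2 (mul_le_mul_of_nonneg_left ?_ hα.le)
    rcases lt_or_gt_of_ne hγ with h | h
    · refine div_le_div_of_nonpos_of_le h.le (sub_le_sub_right (Real.exp_le_exp.2 ?_) _)
      exact mul_le_mul_of_nonpos_left hxy h.le
    · gcongr

theorem gevQuantile_mem_support (μ γ : ℝ) {α : ℝ} (hα : 0 < α) (z : ℝ) :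
    0 < α + γ * (gevQuantile μ γ α z - μ) := by
  unfold gevQuantile
  split_ifs with hγ
  · simpa [hγ] using hα
  · have : α + γ * (μ + α * ((Real.exp (γ * z) - 1) / γ) - μ) = α * Real.exp (γ * z) := by
      field_simp; ring
    rw [this]; positivity

theorem gevExponent_gevQuantile (μ γ : ℝ) {α : ℝ} (hα : 0 < α) (z : ℝ) :
    gevExponent μ γ α (gevQuantile μ γ α z) = Real.exp (-z) := by
  unfold gevExponent gevQuantile
  split_ifs with hγ
  · congr 2; field_simp; ring
  · have : 1 + γ * (μ + α * ((Real.exp (γ * z) - 1) / γ) - μ) / α = Real.exp (γ * z) := by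
      field_simp; ring
    rw [this, ← Real.exp_mul]
    congr 1; field_simp

/-- A continuous increasing function has a measurable lower adjoint. -/
theorem exists_measurable_lowerAdjoint {q : ℝ → ℝ} (hc : Continuous q) (hm : Monotone q) :
    ∃ V : ℝ → EReal, Measurable V ∧ ∀ x z : ℝ, V x ≤ (z : EReal) ↔ x ≤ q z := by
  -- The generalized inverse is extended-valued: it is `⊤` above the range of `q` and `⊥` below it.
  -- Continuity of `q` ensures that a real infimum is attained.
  refine ⟨fun x => sInf ((↑) '' {z : ℝ | x ≤ q z}), Monotone.measurable fun x y hxy => ?_,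
    fun x z => ⟨fun h => ?_, fun h => sInf_le ⟨z, h, rfl⟩⟩⟩
  · exact sInf_le_sInf (image_mono fun z hz => hxy.trans hz)
  · have hgt : ∀ z' > z, x ≤ q z' := fun z' hz' => by
      obtain ⟨_, ⟨w, hw, rfl⟩, hlt⟩ := sInf_lt_iff.1 (h.trans_lt (EReal.coe_lt_coe_iff.2 hz'))
      exact le_trans hw (hm (EReal.coe_lt_coe_iff.1 hlt).le)
    exact ge_of_tendsto ((hc.tendsto z).mono_left (nhdsWithin_le_nhds (s := Ioi z)))
      (eventually_nhdsWithin_of_forall hgt)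

end Quantile

/-! ### Homogeneity and monotonicity of the stable tail dependence function. -/

section TailDependence

variable {d : ℕ}

/-- The sequences `v k` are left free so that the lemma serves both sides of the max-stability
identity, with `m` and with `a k * m + b k` in the other coordinates. -/
theorem tendsto_margin (G : Measure (Fin d → ℝ)) [IsFiniteMeasure G] (j : Fin d) (u : ℝ)
    {v : Fin d → ℕ → ℝ} (hv : ∀ k, Monotone (v k)) (hv' : ∀ k, Tendsto (v k) atTop atTop) :
    Tendsto (fun m => G.real {ω | ∀ k, ω k ≤ Function.update (fun k => v k m) j u k}) atTop
      (𝓝 (G.real {ω | ω j ≤ u})) := by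
  have hm : Monotone fun m => {ω : Fin d → ℝ | ∀ k, ω k ≤ Function.update (fun k => v k m) j u k} :=
    fun m n hmn ω hω k => (hω k).trans
      ((update_le_update_iff.2 ⟨le_rfl, fun k _ => hv k hmn⟩ :
        Function.update (fun k => v k m) j u ≤ Function.update (fun k => v k n) j u) k)
  have ht := tendsto_measure_iUnion_atTop (μ := G) hm
  have hU : ⋃ m, {ω : Fin d → ℝ | ∀ k, ω k ≤ Function.update (fun k => v k m) j u k} =
      {ω | ω j ≤ u} := by
    ext ω
    simp only [mem_iUnion, mem_ofPred_eq]
    refine ⟨fun ⟨m, hω⟩ => by simpa using hω j, fun hω => ?_⟩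
    obtain ⟨m, hm⟩ := (eventually_all.2 fun k => (hv' k).eventually_ge_atTop (ω k)).exists
    refine ⟨m, fun k => ?_⟩
    rcases eq_or_ne k j with rfl | hk
    · simpa using hω
    · simpa [hk] using hm k
  rw [hU] at ht
  exact (ENNReal.tendsto_toReal (measure_ne_top _ _)).comp ht

theorem IsMultivariateGEV.margin_maxStable {μ γ α : Fin d → ℝ} {G : Measure (Fin d → ℝ)}
    (hG : IsMultivariateGEV μ γ α G) {n : ℕ} {a b : Fin d → ℝ} (ha : ∀ j, 0 < a j)
    (hab : ∀ x : Fin d → ℝ,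
      G.real {ω | ∀ j, ω j ≤ a j * x j + b j} ^ n = G.real {ω | ∀ j, ω j ≤ x j})
    (j : Fin d) (u : ℝ) : G.real {ω | ω j ≤ a j * u + b j} ^ n = G.real {ω | ω j ≤ u} := by
  have := hG.isProbabilityMeasure
  have h1 := tendsto_margin G j u (v := fun _ m => (m : ℝ)) (fun _ => Nat.mono_cast)
    fun _ => tendsto_natCast_atTop_atTop
  have h2 := tendsto_margin G j (a j * u + b j) (v := fun k m => a k * (m : ℝ) + b k)
    (fun k m n hmn => by have := (ha k).le; dsimp only; gcongr) fun k =>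
      tendsto_atTop_add_const_right _ _ (tendsto_natCast_atTop_atTop.const_mul_atTop (ha k))
  refine tendsto_nhds_unique (h2.pow n) (h1.congr fun m => ?_)
  rw [← hab]
  congr 3
  ext ω
  refine forall_congr' fun k => ?_
  rcases eq_or_ne k j with rfl | hk
  · simp
  · simp [hk]

/-- The facts about a stable tail dependence function used here, in logarithmic coordinates. -/
theorem IsStdf.exists_quantile {ℓ : (Fin d → ℝ) → ℝ} (hℓ : IsStdf ℓ) :
    ∃ (G : Measure (Fin d → ℝ)) (q : Fin d → ℝ → ℝ), IsProbabilityMeasure G ∧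
      (∀ j, Continuous (q j)) ∧ (∀ j, Monotone (q j)) ∧
      (∀ j z, G.real {ω | ω j ≤ q j z} = Real.exp (-Real.exp (-z))) ∧
      (∀ z : Fin d → ℝ, G.real {ω | ∀ j, ω j ≤ q j (z j)} =
        Real.exp (-ℓ fun j => Real.exp (-z j))) ∧
      ∀ (n : ℕ), 1 ≤ n → ∀ z : Fin d → ℝ,
        n * ℓ (fun j => Real.exp (-(z j + Real.log n))) = ℓ fun j => Real.exp (-z j) := by
  obtain ⟨μ, γ, α, G, hG, hGℓ⟩ := hℓ
  have := hG.isProbabilityMeasure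
  let q : Fin d → ℝ → ℝ := fun j => gevQuantile (μ j) (γ j) (α j)
  have hmargin : ∀ j z, G.real {ω | ω j ≤ q j z} = Real.exp (-Real.exp (-z)) := fun j z => by
    rw [hG.margin j _ (gevQuantile_mem_support _ _ (hG.scale_pos j) z),
      gevExponent_gevQuantile _ _ (hG.scale_pos j)]
  have hjoint : ∀ u y : Fin d → ℝ, (∀ j, G.real {ω | ω j ≤ u j} = Real.exp (-y j)) →
      G.real {ω | ∀ j, ω j ≤ u j} = Real.exp (-ℓ y) := fun u y huy => by
    have := hGℓ (fun j => (u j : EReal)) fun j => by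
      simp only [EReal.coe_le_coe_iff, huy]; positivity
    simpa only [EReal.coe_le_coe_iff, huy, Real.log_exp, neg_neg] using this
  refine ⟨G, q, inferInstance, fun j => continuous_gevQuantile _ _ _,
    fun j => monotone_gevQuantile _ _ (hG.scale_pos j), hmargin,
    fun z => hjoint _ _ fun j => hmargin j (z j), fun n hn z => ?_⟩
  have hn0 : (0 : ℝ) < n := by exact_mod_cast hn
  obtain ⟨a, b, ha, hab⟩ := hG.maxStable n hn
  -- Taking `n`-th roots in the marginal identity: the normalized point has the marginal
  -- probabilities of the quantile at `z + log n`. As the joint probability depends only on the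
  -- marginal ones, the points themselves need not be compared.
  have h1 : ∀ j, G.real {ω | ω j ≤ a j * q j (z j) + b j} =
      Real.exp (-Real.exp (-(z j + Real.log n))) := fun j => by
    refine (pow_left_inj₀ measureReal_nonneg (Real.exp_pos _).le (by omega : n ≠ 0)).1 ?_
    rw [hG.margin_maxStable ha hab, hmargin, ← Real.exp_nat_mul, neg_add, Real.exp_add,
      Real.exp_neg (Real.log n), Real.exp_log hn0]
    congr 1
    field_simp
  have h2 := hab fun j => q j (z j)
  rw [hjoint _ _ h1, hjoint _ _ fun j => hmargin j (z j), ← Real.exp_nat_mul, Real.exp_eq_exp] at h2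
  linarith

/-- An antitone function with `L (z + log n) = L z / n` satisfies `L (z + t) = exp (-t) L z`. -/
theorem translate_eq_exp_mul {L : (Fin d → ℝ) → ℝ} (hanti : Antitone L) (hpos : ∀ z, 0 < L z)
    (hnat : ∀ n : ℕ, 1 ≤ n → ∀ z, n * L (fun j => z j + Real.log n) = L z) (z : Fin d → ℝ) (t : ℝ) :
    L (fun j => z j + t) = Real.exp (-t) * L z := by
  have hrat : ∀ r : ℚ, 0 < r → (r : ℝ) * L (fun j => z j + Real.log r) = L z := by
    intro r hr
    have hnum : 0 < r.num := Rat.num_pos.2 hr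
    obtain ⟨p, hp⟩ := Int.eq_ofNat_of_zero_le hnum.le
    have hp0 : 1 ≤ p := by omega
    have hden : (0 : ℝ) < r.den := by exact_mod_cast r.den_pos
    have hpR : (0 : ℝ) < p := by exact_mod_cast hp0
    have hreq : (r : ℝ) = p / r.den := by
      rw [Rat.cast_def, hp, Int.cast_natCast]
    -- With `r = p / s`, the scalings by `s` from `z + log r` and by `p` from `z` end at the same
    -- point `z + log p`.
    have h1 := hnat r.den r.den_pos fun j => z j + Real.log r
    have h2 := hnat p hp0 z
    have h3 : (fun j => z j + Real.log r + Real.log r.den) = fun j => z j + Real.log p := by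
      ext j
      rw [hreq, Real.log_div hpR.ne' hden.ne']; ring
    rw [h3] at h1
    rw [← h1, hreq, ← h2]
    field_simp
  -- Monotonicity squeezes `exp t` between rationals, where the identity is already known.
  have hle : ∀ r : ℚ, 0 < r → (r : ℝ) < Real.exp t → (r : ℝ) * L (fun j => z j + t) ≤ L z := by
    intro r hr hrt
    have hr' : (0 : ℝ) < r := by exact_mod_cast hr
    rw [← hrat r hr]
    refine mul_le_mul_of_nonneg_left (hanti fun j => ?_) hr'.le
    have := (Real.log_lt_iff_lt_exp hr').2 hrt
    linarith
  have hge : ∀ r : ℚ, Real.exp t < r → L z ≤ r * L (fun j => z j + t) := by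
    intro r hrt
    have hr' : (0 : ℝ) < r := (Real.exp_pos t).trans hrt
    rw [← hrat r (by exact_mod_cast hr')]
    refine mul_le_mul_of_nonneg_left (hanti fun j => ?_) hr'.le
    have := (Real.lt_log_iff_exp_lt hr').2 hrt
    linarith
  have hP := hpos fun j => z j + t
  have hmain : Real.exp t = L z / L (fun j => z j + t) := by
    apply le_antisymm
    · by_contra! h
      obtain ⟨r, hr1, hr2⟩ := exists_rat_btwn h
      have hr : (0 : ℝ) < r := (div_pos (hpos z) hP).trans hr1
      rw [div_lt_iff₀ hP] at hr1
      exact (hle r (by exact_mod_cast hr) hr2).not_gt hr1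
    · by_contra! h
      obtain ⟨r, hr1, hr2⟩ := exists_rat_btwn h
      rw [lt_div_iff₀ hP] at hr2
      exact (hge r hr1).not_gt hr2
  rw [Real.exp_neg, hmain]
  field_simp [(hpos z).ne', hP.ne']

/-- The function `z ↦ ℓ (π e⁻ᶻ)` of a stable tail dependence function `ℓ`. -/
theorem IsStdf.exists_law [Nonempty (Fin d)] {ℓ : (Fin d → ℝ) → ℝ} (hℓ : IsStdf ℓ)
    {π : Fin d → ℝ} (hπ : ∀ j, 0 < π j) :
    (∃ Q : Measure (Fin d → EReal), IsProbabilityMeasure Q ∧ ∀ z : Fin d → ℝ,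
      Q.real {w | ∀ j, w j ≤ (z j : EReal)} = Real.exp (-ℓ fun j => π j * Real.exp (-z j))) ∧
    (Antitone fun z : Fin d → ℝ => ℓ fun j => π j * Real.exp (-z j)) ∧
    (∀ (z : Fin d → ℝ) j, π j * Real.exp (-z j) ≤ ℓ fun j => π j * Real.exp (-z j)) ∧
    ∀ (z : Fin d → ℝ) (t : ℝ), (ℓ fun j => π j * Real.exp (-(z j + t))) =
      Real.exp (-t) * ℓ fun j => π j * Real.exp (-z j) := by
  obtain ⟨G, q, hGp, hqc, hqm, hmargin, hjoint, hnat⟩ := hℓ.exists_quantile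
  -- The factor `π j` is absorbed by translating the logarithmic coordinate by `log (π j)`.
  have hexp : ∀ j (z : ℝ), Real.exp (-(z - Real.log (π j))) = π j * Real.exp (-z) := fun j z => by
    rw [neg_sub, sub_eq_add_neg, Real.exp_add, Real.exp_log (hπ j)]
  have hjoint' : ∀ z : Fin d → ℝ, G.real {ω | ∀ j, ω j ≤ q j (z j - Real.log (π j))} =
      Real.exp (-ℓ fun j => π j * Real.exp (-z j)) := fun z => by
    simpa only [hexp] using hjoint fun j => z j - Real.log (π j)
  have hanti : Antitone fun z : Fin d → ℝ => ℓ fun j => π j * Real.exp (-z j) := fun z z' hz => by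
    rw [← neg_le_neg_iff, ← Real.exp_le_exp, ← hjoint', ← hjoint']
    exact measureReal_mono fun ω hω j => (hω j).trans (hqm j (sub_le_sub_right (hz j) _))
  -- A joint probability is at most each marginal one; taking `-log` reverses the inequality.
  have hlower : ∀ (z : Fin d → ℝ) j,
      π j * Real.exp (-z j) ≤ ℓ fun j => π j * Real.exp (-z j) := fun z j => by
    rw [← neg_le_neg_iff, ← Real.exp_le_exp, ← hjoint', ← hexp, ← hmargin]
    exact measureReal_mono fun ω hω => hω j
  refine ⟨?_, hanti, hlower, ?_⟩
  · choose V hVm hV using fun j => exists_measurable_lowerAdjoint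
      ((hqc j).comp (continuous_id.sub (continuous_const (y := Real.log (π j)))))
      fun x y hxy => hqm j (sub_le_sub_right hxy (Real.log (π j)))
    have hm : Measurable fun (ω : Fin d → ℝ) j => V j (ω j) := by fun_prop
    refine ⟨G.map fun ω j => V j (ω j), Measure.isProbabilityMeasure_map hm.aemeasurable,
      fun z => ?_⟩
    rw [map_measureReal_apply hm (measurableSet_box _), ← hjoint']
    congr 1
    ext ω
    exact forall_congr' fun j => hV j _ _
  · refine translate_eq_exp_mul (L := fun z => ℓ fun j => π j * Real.exp (-z j)) hanti
      (fun z => ?_) fun n hn z => ?_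
    · have j := Classical.arbitrary (Fin d)
      exact (mul_pos (hπ j) (Real.exp_pos _)).trans_le (hlower z j)
    · have := hnat n hn fun j => z j - Real.log (π j)
      have hcomm : ∀ j, z j - Real.log (π j) + Real.log n = z j + Real.log n - Real.log (π j) :=
        fun j => by ring
      simp only [hcomm, hexp] at this
      exact this

end TailDependence

/-! ### Conclusion. -/

/-- In dimension zero the only box is the whole space, so `exp (-ℓ π) = 1`, which is incompatible
with `ℓ π = 1`. -/
theorem IsStdf.nonempty {d : ℕ} {ℓ : (Fin d → ℝ) → ℝ} (hℓ : IsStdf ℓ) {π : Fin d → ℝ}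
    (hπℓ : ℓ π = 1) : Nonempty (Fin d) := by
  by_contra hne
  rw [not_nonempty_iff] at hne
  obtain ⟨G, q, hGp, -, -, -, hjoint, -⟩ := hℓ.exists_quantile
  have h := hjoint 0
  rw [Subsingleton.elim (fun j => Real.exp (-(0 : Fin d → ℝ) j)) π, hπℓ] at h
  simp [eq_comm (a := (1 : ℝ))] at h

theorem mainTheorem2 {d : ℕ} (π : Fin d → ℝ) (hπ : ∀ j, 0 < π j ∧ π j ≤ 1)
    (ℓ : (Fin d → ℝ) → ℝ) (hℓ : IsStdf ℓ) (hπℓ : ℓ π = 1) :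
    (∃! H : Measure (Fin d → EReal), IsStandardGP π ℓ H) ∧
      ∃! ν : Measure (Fin d → EReal), IsSpectralLaw ν ∧
        ∀ H : Measure (Fin d → EReal), IsStandardGP π ℓ H → H = addExpLaw ν := by
  have hne := hℓ.nonempty hπℓ
  obtain ⟨⟨Q, hQp, hQ⟩, hanti, hlower, hL⟩ := hℓ.exists_law fun j => (hπ j).1
  have hL0 : (ℓ fun j => π j * Real.exp (-(0 : Fin d → ℝ) j)) = 1 := by simpa using hπℓ
  obtain ⟨H, hHp, hH⟩ := exists_probabilityMeasure_cdf
    (L := fun z => ℓ fun j => π j * Real.exp (-z j)) hanti hL hL0 Q hQ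
  have htop := ae_lt_top_of_cdf (L := fun z => ℓ fun j => π j * Real.exp (-z j)) hL hL0 hH
  have hGP : IsStandardGP π ℓ H := ⟨hHp, htop, hH⟩
  have huniq : ∀ H', IsStandardGP π ℓ H' → H' = H := fun H' hH' => by
    have := hH'.isProbabilityMeasure
    refine ext_of_forall_real_box hH'.lt_top htop fun z => ?_
    rw [← ofReal_measureReal, ← ofReal_measureReal, hH'.cdf, hH]
  have hstab := isThresholdStable_of_cdf (L := fun z => ℓ fun j => π j * Real.exp (-z j)) hL htop hH
  refine ⟨⟨H, hGP, huniq⟩, H.map spectralPart, ⟨hstab.isSpectralLaw fun j => ?_, fun H' hH' => ?_⟩,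
    fun ν ⟨hν, hνH⟩ => ?_⟩
  -- If `Z j = ⊥` almost surely, lowering the `j`-th bound of the box `[-∞, M]^d` to `0` loses no
  -- mass, hence `L u ≤ e^(-M)`. But `L u ≥ π j` since `u j = 0`, and `M` is chosen with `e^(-M) < π
  -- j`.
  · by_contra hzero
    have hbot : ∀ᵐ z ∂H, z j = ⊥ := by
      rw [ae_iff]
      simpa [bot_lt_iff_ne_bot] using hzero
    obtain ⟨M, hM0, hM⟩ : ∃ M : ℝ, 0 ≤ M ∧ Real.exp (-M) < π j :=
      ((eventually_ge_atTop 0).and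
        (Real.tendsto_exp_neg_atTop_nhds_zero.eventually_lt_const (hπ j).1)).exists
    let u : Fin d → ℝ := Function.update (fun _ => M) j 0
    have hle : H.real {w : Fin d → EReal | ∀ k, w k ≤ (M : EReal)} ≤
        H.real {w : Fin d → EReal | ∀ k, w k ≤ (u k : EReal)} := by
      refine ENNReal.toReal_mono (measure_ne_top _ _) (measure_mono_ae ?_)
      filter_upwards [hbot] with w hw hwM k
      rcases eq_or_ne k j with rfl | hk
      · simp [hw]
      · simpa [u, hk] using hwM k
    have hmin : ∀ k, min (u k) 0 = 0 := fun k => by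
      rcases eq_or_ne k j with rfl | hk
      · simp [u]
      · simpa [u, hk] using hM0
    have h1 := hlower u j
    have h2 := hL 0 M
    rw [hL0] at h2
    rw [hH fun _ => M, hH u] at hle
    simp only [hmin, min_eq_right hM0, Pi.zero_apply, zero_add, mul_one] at hL0 h2 hle
    simp only [u, Function.update_self, neg_zero, Real.exp_zero, mul_one] at h1 hle
    linarith
  · rw [huniq H' hH']
    exact hstab.eq_addExpLaw
  -- Any competing spectral law is the law of the spectral part of the same `H`.
  · rw [hνH H hGP, hν.map_spectralPart_addExpLaw]
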